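/- Let $(\Omega,\mathcal F,\mathbb P)$ be an atomless probability space. For a random variable $Y:\Omega\to\mathbb R$ with distribution function $F_Y$ let $$\mathrm{VaR}_t(Y)=\inf\{x\in\mathbb R: F_Y(x)\ge t\},\qquad t\in(0,1),$$ and, if $Y$ is integrable and $\alpha\in(0,1)$, let $$\mathrm{ES}_\alpha(Y)=\frac1{1-\alpha}\int_\alpha^1\mathrm{VaR}_t(Y)\,\mathrm dt,\qquad \mathrm{ES}^L_\alpha(Y)=\frac1\alpha\int_0^\alpha\mathrm{VaR}_t(Y)\,\mathrm dt .$$ For $p>1$, $m\in\mathbb R$ and $v>0$ let $\mathcal M^p(m,v)$ be the set of distributions $F_Y$ of integrable random variables $Y$ with $\mathbb E[Y]=m$ and $\mathbb E[|Y-m|^p]\le v^p$. Then, for all $\alpha\in(0,1)$, $p>1$, $m\in\mathbb R$ and $v>0$, the function $t\mapsto\mathrm{VaR}_t(Y)$ is integrable on $(0,1)$ whenever $F_Y\in\mathcal M^p(m,v)$, and $$\sup_{F_Y\in\mathcal M^p(m,v)}\mathrm{VaR}_\alpha(Y)=\max_{F_Y\in\mathcal M^p(m,v)}\mathrm{ES}_\alpha(Y)=m+v\alpha\left(\alpha^p(1-\alpha)+(1-\alpha)^p\alpha\right)^{-1/p},$$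 $$\inf_{F_Y\in\mathcal M^p(m,v)}\mathrm{VaR}_\alpha(Y)=\min_{F_Y\in\mathcal M^p(m,v)}\mathrm{ES}^L_\alpha(Y)=m-v(1-\alpha)\left(\alpha^p(1-\alpha)+(1-\alpha)^p\alpha\right)^{-1/p},$$ where the maximum and the minimum are attained. -/

import Mathlib

open MeasureTheory ProbabilityTheory

noncomputable section

namespace RiskMeasure

/-- A measure is atomless if every measurable set of positive measure has a measurable subset of
strictly smaller positive measure. -/
def Atomless {Ω : Type*} [MeasurableSpace Ω] (P : Measure Ω) : Prop :=
  ∀ s : Set Ω, MeasurableSet s → 0 < P s →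
    ∃ t : Set Ω, t ⊆ s ∧ MeasurableSet t ∧ 0 < P t ∧ P t < P s

/-- The left quantile `inf {x | t ≤ F x}` of the distribution on `ℝ` with distribution function
`F = cdf μ`. For `t` in `(0,1)` and a probability measure `μ`, the set is nonempty and bounded
below, so that the infimum is the true one. -/
def leftQuantile (μ : Measure ℝ) (t : ℝ) : ℝ :=
  sInf {x : ℝ | t ≤ cdf μ x}

/-- The Value-at-Risk of the random variable `Y` at level `t`. -/
def VaR {Ω : Type*} [MeasurableSpace Ω] (P : Measure Ω) (t : ℝ) (Y : Ω → ℝ) : ℝ :=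
  leftQuantile (P.map Y) t

/-- The Expected Shortfall of `Y` at level `α`. -/
def ES {Ω : Type*} [MeasurableSpace Ω] (P : Measure Ω) (α : ℝ) (Y : Ω → ℝ) : ℝ :=
  (1 / (1 - α)) * ∫ t in α..1, VaR P t Y

/-- The left Expected Shortfall of `Y` at level `α`. -/
def leftES {Ω : Type*} [MeasurableSpace Ω] (P : Measure Ω) (α : ℝ) (Y : Ω → ℝ) : ℝ :=
  (1 / α) * ∫ t in (0 : ℝ)..α, VaR P t Y

/-- The set of distributions on `ℝ` with finite mean, equal to `m`, and with absolute central
moment of order `p` finite and at most `v ^ p`. -/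
def momentSet (p m v : ℝ) : Set (Measure ℝ) :=
  {μ | IsProbabilityMeasure μ ∧
    Integrable (fun y : ℝ => y) μ ∧ ∫ y, y ∂μ = m ∧
    Integrable (fun y : ℝ => |y - m| ^ p) μ ∧ ∫ y, |y - m| ^ p ∂μ ≤ v ^ p}

/-- The random variables on `(Ω, P)` whose distribution belongs to `M`. -/
def withLawIn {Ω : Type*} [MeasurableSpace Ω] (P : Measure Ω) (M : Set (Measure ℝ)) :
    Set (Ω → ℝ) :=
  {Y | Measurable Y ∧ P.map Y ∈ M}

end RiskMeasure

end

/-! Under Lebesgue measure on `(0, 1)` the quantile function `q` has law `μ` (`map_leftQuantile`),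
so `q - m` has integral `0` and `p`-th absolute moment at most `v ^ p`. Its integrals over `(0, α)`
and `(α, 1)` are opposite, with common absolute value `C`. Jensen on each interval gives `s ^ p * K
≤ v ^ p` for `s = C / (α * (1 - α))` and `K = α ^ p * (1 - α) + (1 - α) ^ p * α`
(`abs_integral_leftQuantile_le`). This bounds `ES` and `leftES`, and `VaR` lies between them because
`q` is monotone.

Equality holds for the law with mass `α` at `m - s * (1 - α)` and `1 - α` at `m + s * α`, where `s =
v * K ^ (-(1 / p))`; atomlessness realises it on `Ω` (`Atomless.exists_extremal`). Its left quantile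
at `α` is the lower atom, so the infimum of `VaR` is attained, while the supremum is approached with
lower mass `β ↑ α`. -/

namespace RiskMeasure

open Set Filter Topology

/-! ### Values of atomless measures -/

section Sierpinski

variable {Ω : Type*} [MeasurableSpace Ω] {P : Measure Ω}

/-- Splitting a set into two pieces of positive measure leaves one with at most half the measure. -/
lemma Atomless.exists_subset_real_le_div_two_pow [IsFiniteMeasure P] (hP : Atomless P) {s : Set Ω}
    (hs : MeasurableSet s) (hs0 : 0 < P.real s) (n : ℕ) :
    ∃ t ⊆ s, MeasurableSet t ∧ 0 < P.real t ∧ P.real t ≤ P.real s / 2 ^ n := by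
  induction n with
  | zero => exact ⟨s, subset_rfl, hs, hs0, by simp⟩
  | succ n ih =>
    obtain ⟨t, hts, ht, ht0, htn⟩ := ih
    obtain ⟨u, hut, hu, hu0, hult⟩ := hP t ht (ENNReal.toReal_pos_iff.1 ht0).1
    have hu0' : 0 < P.real u := ENNReal.toReal_pos hu0.ne' (measure_ne_top _ _)
    have hult' : P.real u < P.real t :=
      (ENNReal.toReal_lt_toReal (measure_ne_top _ _) (measure_ne_top _ _)).2 hult
    have hdiff : P.real (t \ u) = P.real t - P.real u := measureReal_sdiff hut hu
    have hpow : P.real s / 2 ^ (n + 1) = P.real s / 2 ^ n / 2 := by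
      rw [pow_succ, div_div]
    rcases le_total (P.real u) (P.real t / 2) with h | h
    · exact ⟨u, hut.trans hts, hu, hu0', by linarith⟩
    · exact ⟨t \ u, sdiff_subset.trans hts, ht.diff hu, by linarith, by linarith⟩

lemma Atomless.exists_subset_real_le [IsFiniteMeasure P] (hP : Atomless P) {s : Set Ω}
    (hs : MeasurableSet s) (hs0 : 0 < P.real s) {ε : ℝ} (hε : 0 < ε) :
    ∃ t ⊆ s, MeasurableSet t ∧ 0 < P.real t ∧ P.real t ≤ ε := by
  obtain ⟨n, hn⟩ := pow_unbounded_of_one_lt (P.real s / ε) one_lt_two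
  obtain ⟨t, hts, ht, ht0, htn⟩ := hP.exists_subset_real_le_div_two_pow hs hs0 n
  refine ⟨t, hts, ht, ht0, htn.trans ?_⟩
  rw [div_lt_iff₀ hε] at hn
  rw [div_le_iff₀ (by positivity)]
  linarith

/-- Among the measurable supersets of `A` of measure at most `β`, some set realises at least half
of the largest possible increase of measure. -/
lemma exists_superset_half_optimal (P : Measure Ω) {β : ℝ} {A : Set Ω}
    (hA : MeasurableSet A) (hAβ : P.real A ≤ β) :
    ∃ B, A ⊆ B ∧ MeasurableSet B ∧ P.real B ≤ β ∧
      ∀ C, A ⊆ C → MeasurableSet C → P.real C ≤ β →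
        P.real C - P.real A ≤ 2 * (P.real B - P.real A) := by
  set S : Set ℝ := {x | ∃ C, A ⊆ C ∧ MeasurableSet C ∧ P.real C ≤ β ∧ P.real C = x}
  have hAS : P.real A ∈ S := ⟨A, subset_rfl, hA, hAβ, rfl⟩
  have hbdd : BddAbove S := ⟨β, by rintro _ ⟨C, -, -, h, rfl⟩; exact h⟩
  have hle : ∀ C, A ⊆ C → MeasurableSet C → P.real C ≤ β → P.real C ≤ sSup S :=
    fun C h1 h2 h3 ↦ le_csSup hbdd ⟨C, h1, h2, h3, rfl⟩
  rcases (le_csSup hbdd hAS).eq_or_lt with h | h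
  · refine ⟨A, subset_rfl, hA, hAβ, fun C h1 h2 h3 ↦ ?_⟩
    have := hle C h1 h2 h3
    linarith
  · obtain ⟨_, ⟨B, h1, h2, h3, rfl⟩, hB⟩ :=
      exists_lt_of_lt_csSup ⟨_, hAS⟩ (show (P.real A + sSup S) / 2 < sSup S by linarith)
    refine ⟨B, h1, h2, h3, fun C h1 h2 h3 ↦ ?_⟩
    have := hle C h1 h2 h3
    linarith

/-- **Sierpiński's theorem**: an atomless probability measure takes every value in `[0, 1]`. -/
lemma Atomless.exists_real_eq [IsProbabilityMeasure P] (hP : Atomless P) {β : ℝ}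
    (hβ0 : 0 ≤ β) (hβ1 : β ≤ 1) : ∃ A, MeasurableSet A ∧ P.real A = β := by
  choose! G hsub hmeas hle hopt using
    fun A : Set Ω ↦ fun h : MeasurableSet A ∧ P.real A ≤ β ↦
      exists_superset_half_optimal P h.1 h.2
  -- Greedy exhaustion: each step makes at least half of the best possible gain.
  let A : ℕ → Set Ω := fun n ↦ G^[n] ∅
  have hsucc : ∀ n, A (n + 1) = G (A n) := fun n ↦ Function.iterate_succ_apply' G n ∅
  have hA : ∀ n, MeasurableSet (A n) ∧ P.real (A n) ≤ β := by
    intro n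
    induction n with
    | zero => exact ⟨MeasurableSet.empty, by simpa [A] using hβ0⟩
    | succ n ih => rw [hsucc]; exact ⟨hmeas _ ih, hle _ ih⟩
  have hmono : Monotone A := monotone_nat_of_le_succ fun n ↦ by
    rw [hsucc]; exact hsub _ (hA n)
  have hlim : Tendsto (fun n ↦ P.real (A n)) atTop (𝓝 (P.real (⋃ n, A n))) :=
    (ENNReal.tendsto_toReal (measure_ne_top _ _)).comp (tendsto_measure_iUnion_atTop hmono)
  have hU : MeasurableSet (⋃ n, A n) := MeasurableSet.iUnion fun n ↦ (hA n).1
  have hUβ : P.real (⋃ n, A n) ≤ β := le_of_tendsto' hlim fun n ↦ (hA n).2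
  refine ⟨_, hU, hUβ.eq_of_not_lt fun hlt ↦ ?_⟩
  have hc : 0 < P.real (⋃ n, A n)ᶜ := by
    rw [probReal_compl_eq_one_sub hU]; linarith
  obtain ⟨C, hCU, hC, hC0, hCle⟩ := hP.exists_subset_real_le hU.compl hc (sub_pos.2 hlt)
  -- `C` lies outside the union and could be added at every stage, so every gain is at least half of
  -- `P.real C`; but the gains tend to `0`.
  have hstep : ∀ n, P.real C ≤ 2 * (P.real (A (n + 1)) - P.real (A n)) := by
    intro n
    have hdisj : Disjoint (A n) C :=
      (disjoint_compl_right.mono_right hCU).mono_left (subset_iUnion A n)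
    have hunion : P.real (A n ∪ C) = P.real (A n) + P.real C := measureReal_union hdisj hC
    have hAU : P.real (A n) ≤ P.real (⋃ n, A n) := measureReal_mono (subset_iUnion A n)
    have := hopt (A n) (hA n) (A n ∪ C) subset_union_left ((hA n).1.union hC) (by linarith)
    rw [← hsucc] at this
    linarith
  have hzero : Tendsto (fun n ↦ 2 * (P.real (A (n + 1)) - P.real (A n))) atTop (𝓝 0) := by
    simpa using (((tendsto_add_atTop_iff_nat 1).2 hlim).sub hlim).const_mul 2
  exact absurd (ge_of_tendsto' hzero hstep) (not_le.2 hC0)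

end Sierpinski

/-! ### The quantile transform -/

section Quantile

variable (μ : Measure ℝ)

/-- Right-continuity of the distribution function makes the infimum attained. -/
lemma leftQuantile_le_iff {t x : ℝ} (ht0 : 0 < t) (ht1 : t < 1) :
    leftQuantile μ t ≤ x ↔ t ≤ cdf μ x := by
  have hbdd : BddBelow {x : ℝ | t ≤ cdf μ x} := by
    obtain ⟨a, ha⟩ := ((tendsto_cdf_atBot μ).eventually (gt_mem_nhds ht0)).exists
    exact ⟨a, fun y hy ↦ le_of_not_gt fun h ↦
      absurd (hy.trans (monotone_cdf μ h.le)) (not_le.2 ha)⟩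
  have hne : {x : ℝ | t ≤ cdf μ x}.Nonempty :=
    (((tendsto_cdf_atTop μ).eventually (lt_mem_nhds ht1)).mono fun _ h ↦ h.le).exists
  refine ⟨fun h ↦ ?_, fun h ↦ csInf_le hbdd h⟩
  have hlim : Tendsto (cdf μ) (𝓝[>] x) (𝓝 (cdf μ x)) :=
    ((cdf μ).right_continuous x).mono Ioi_subset_Ici_self
  refine ge_of_tendsto hlim (eventually_mem_nhdsWithin.mono fun y hy ↦ ?_)
  obtain ⟨z, hz, hzy⟩ := exists_lt_of_csInf_lt hne (lt_of_le_of_lt h hy)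
  exact hz.trans (monotone_cdf μ hzy.le)

lemma monotoneOn_leftQuantile : MonotoneOn (leftQuantile μ) (Ioo 0 1) := fun _ hs _ ht hst ↦
  (leftQuantile_le_iff μ hs.1 hs.2).2 (hst.trans ((leftQuantile_le_iff μ ht.1 ht.2).1 le_rfl))

lemma aemeasurable_leftQuantile :
    AEMeasurable (leftQuantile μ) (volume.restrict (Ioo (0 : ℝ) 1)) :=
  aemeasurable_restrict_of_monotoneOn measurableSet_Ioo (monotoneOn_leftQuantile μ)

/-- The left quantile function transports the uniform distribution on `(0, 1)` to `μ`. -/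
lemma map_leftQuantile [IsProbabilityMeasure μ] :
    (volume.restrict (Ioo (0 : ℝ) 1)).map (leftQuantile μ) = μ := by
  have : IsFiniteMeasure ((volume.restrict (Ioo (0 : ℝ) 1)).map (leftQuantile μ)) :=
    inferInstance
  refine Measure.ext_of_Iic _ _ fun x ↦ ?_
  rw [Measure.map_apply_of_aemeasurable (aemeasurable_leftQuantile μ) measurableSet_Iic,
    Measure.restrict_apply₀' measurableSet_Ioo.nullMeasurableSet]
  have h : leftQuantile μ ⁻¹' Iic x ∩ Ioo 0 1 = Iic (cdf μ x) ∩ Ioo 0 1 := by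
    ext t
    simp only [mem_inter_iff, mem_preimage, mem_Iic]
    exact and_congr_left fun ht ↦ leftQuantile_le_iff μ ht.1 ht.2
  -- The half-open interval also covers the case where the distribution function equals `1`.
  rw [h, measure_congr ((ae_eq_refl _).inter Ioo_ae_eq_Ioc), inter_comm, Ioc_inter_Iic,
    Real.volume_Ioc, min_eq_right (cdf_le_one μ x), sub_zero, ofReal_cdf]

variable {μ}

lemma integrableOn_comp_leftQuantile [IsProbabilityMeasure μ] {g : ℝ → ℝ} (hg : Integrable g μ) :
    IntegrableOn (fun t ↦ g (leftQuantile μ t)) (Ioo 0 1) := by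
  rw [← map_leftQuantile μ] at hg
  exact hg.comp_aemeasurable (aemeasurable_leftQuantile μ)

lemma intervalIntegrable_comp_leftQuantile [IsProbabilityMeasure μ] {g : ℝ → ℝ}
    (hg : Integrable g μ) : IntervalIntegrable (fun t ↦ g (leftQuantile μ t)) volume 0 1 :=
  (intervalIntegrable_iff_integrableOn_Ioo_of_le zero_le_one).2 (integrableOn_comp_leftQuantile hg)

lemma intervalIntegral_comp_leftQuantile [IsProbabilityMeasure μ] {g : ℝ → ℝ}
    (hg : Integrable g μ) : ∫ t in (0 : ℝ)..1, g (leftQuantile μ t) = ∫ y, g y ∂μ := by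
  rw [intervalIntegral.integral_of_le zero_le_one, integral_Ioc_eq_integral_Ioo]
  conv_rhs => rw [← map_leftQuantile μ]
  refine (integral_map (aemeasurable_leftQuantile μ) ?_).symm
  rw [map_leftQuantile μ]
  exact hg.aestronglyMeasurable

end Quantile

/-! ### Jensen's inequality on an interval -/

section Jensen

lemma sub_mul_div_rpow_le_integral {f : ℝ → ℝ} {a b p : ℝ} (hab : a < b) (hp : 1 ≤ p)
    (hf : IntervalIntegrable f volume a b)
    (hfp : IntervalIntegrable (fun t ↦ |f t| ^ p) volume a b) :
    (b - a) * (|∫ t in a..b, f t| / (b - a)) ^ p ≤ ∫ t in a..b, |f t| ^ p := by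
  have hba : 0 < b - a := sub_pos.2 hab
  have hvol : volume.real (Ioc a b) = b - a := by simp [hab.le]
  have hJ := (convexOn_rpow hp).map_set_average_le (μ := volume) (t := Ioc a b)
    (f := fun t ↦ |f t|) (fun x _ ↦ (Real.continuousAt_rpow_const x p
      (Or.inr (by linarith))).continuousWithinAt) isClosed_Ici
    (by simp [hab]) (by simp) (ae_of_all _ fun t ↦ abs_nonneg (f t))
    ((intervalIntegrable_iff_integrableOn_Ioc_of_le hab.le).1 hf).abs
    ((intervalIntegrable_iff_integrableOn_Ioc_of_le hab.le).1 hfp)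
  rw [setAverage_eq, setAverage_eq, hvol, ← intervalIntegral.integral_of_le hab.le,
    ← intervalIntegral.integral_of_le hab.le, smul_eq_mul, smul_eq_mul,
    ← div_eq_inv_mul, ← div_eq_inv_mul, le_div_iff₀' hba] at hJ
  refine le_trans ?_ hJ
  gcongr
  exact intervalIntegral.abs_integral_le_integral_abs hab.le

end Jensen

end RiskMeasure

namespace RiskMeasure

open Set Filter Topology

/-! ### Upper and lower bounds -/

section Bounds

lemma momentConstant_pos {α : ℝ} (p : ℝ) (hα0 : 0 < α) (hα1 : α < 1) :
    0 < α ^ p * (1 - α) + (1 - α) ^ p * α := by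
  have : 0 < 1 - α := sub_pos.2 hα1
  positivity

lemma mul_rpow_neg_inv_rpow {v p K : ℝ} (hp : 0 < p) (hv : 0 ≤ v) (hK : 0 < K) :
    (v * K ^ (-(1 / p))) ^ p * K = v ^ p := by
  rw [Real.mul_rpow hv (by positivity), ← Real.rpow_mul hK.le, neg_mul, one_div,
    inv_mul_cancel₀ hp.ne', Real.rpow_neg_one, mul_assoc, inv_mul_cancel₀ hK.ne', mul_one]

lemma le_mul_rpow_neg_inv {s v p K : ℝ} (hp : 0 < p) (hs : 0 ≤ s) (hv : 0 ≤ v) (hK : 0 < K)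
    (h : s ^ p * K ≤ v ^ p) : s ≤ v * K ^ (-(1 / p)) := by
  rw [← mul_rpow_neg_inv_rpow hp hv hK] at h
  exact (Real.rpow_le_rpow_iff hs (by positivity) hp).1 (le_of_mul_le_mul_right h hK)

lemma intervalIntegrable_leftQuantile {p m v : ℝ} {μ : Measure ℝ} (hμ : μ ∈ momentSet p m v) :
    IntervalIntegrable (leftQuantile μ) volume 0 1 := by
  have := hμ.1
  exact intervalIntegrable_comp_leftQuantile (g := fun y ↦ y) hμ.2.1

variable {α p m v : ℝ}

lemma integral_leftQuantile_add_adjacent {μ : Measure ℝ} (hμ : μ ∈ momentSet p m v)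
    (hα0 : 0 < α) (hα1 : α < 1) :
    (∫ t in (0 : ℝ)..α, (leftQuantile μ t - m)) + ∫ t in α..1, (leftQuantile μ t - m) = 0 := by
  have := hμ.1
  have hI : IntervalIntegrable (fun t ↦ leftQuantile μ t - m) volume 0 1 :=
    (intervalIntegrable_leftQuantile hμ).sub intervalIntegrable_const
  have hαm : α ∈ uIcc (0 : ℝ) 1 := by rw [uIcc_of_le zero_le_one]; exact ⟨hα0.le, hα1.le⟩
  rw [intervalIntegral.integral_add_adjacent_intervals
    (hI.mono_set (uIcc_subset_uIcc left_mem_uIcc hαm))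
    (hI.mono_set (uIcc_subset_uIcc hαm right_mem_uIcc)),
    intervalIntegral.integral_sub (intervalIntegrable_leftQuantile hμ) intervalIntegrable_const,
    intervalIntegral_comp_leftQuantile (g := fun y ↦ y) hμ.2.1, hμ.2.2.1]
  simp

/-- The tail integral of the centred quantile function is controlled by Jensen's inequality on
`(0, α)` and on `(α, 1)`. -/
lemma abs_integral_leftQuantile_le {μ : Measure ℝ} (hμ : μ ∈ momentSet p m v)
    (hα0 : 0 < α) (hα1 : α < 1) (hp : 1 < p) (hv : 0 < v) :
    |∫ t in α..1, (leftQuantile μ t - m)| ≤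
      α * (1 - α) * (v * (α ^ p * (1 - α) + (1 - α) ^ p * α) ^ (-(1 / p))) := by
  have := hμ.1
  have h1α : 0 < 1 - α := sub_pos.2 hα1
  have hI : IntervalIntegrable (fun t ↦ leftQuantile μ t - m) volume 0 1 :=
    (intervalIntegrable_leftQuantile hμ).sub intervalIntegrable_const
  have hIp : IntervalIntegrable (fun t ↦ |leftQuantile μ t - m| ^ p) volume 0 1 :=
    intervalIntegrable_comp_leftQuantile (g := fun y ↦ |y - m| ^ p) hμ.2.2.2.1
  have hαm : α ∈ uIcc (0 : ℝ) 1 := by rw [uIcc_of_le zero_le_one]; exact ⟨hα0.le, hα1.le⟩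
  have hl := uIcc_subset_uIcc left_mem_uIcc hαm
  have hr := uIcc_subset_uIcc hαm right_mem_uIcc
  have hJl := sub_mul_div_rpow_le_integral hα0 hp.le (hI.mono_set hl) (hIp.mono_set hl)
  have hJr := sub_mul_div_rpow_le_integral hα1 hp.le (hI.mono_set hr) (hIp.mono_set hr)
  have hsum := intervalIntegral.integral_add_adjacent_intervals (hIp.mono_set hl)
    (hIp.mono_set hr)
  rw [intervalIntegral_comp_leftQuantile (g := fun y ↦ |y - m| ^ p) hμ.2.2.2.1] at hsum
  have hmoment := hμ.2.2.2.2
  rw [eq_neg_of_add_eq_zero_left (integral_leftQuantile_add_adjacent hμ hα0 hα1), abs_neg,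
    sub_zero] at hJl
  set C := |∫ t in α..1, (leftQuantile μ t - m)| with hC
  have hC0 : 0 ≤ C := abs_nonneg _
  rw [← div_le_iff₀' (by positivity)]
  have hs : 0 ≤ C / (α * (1 - α)) := by positivity
  refine le_mul_rpow_neg_inv (by linarith) hs hv.le (momentConstant_pos p hα0 hα1) ?_
  -- In terms of `C / (α * (1 - α))` both Jensen bounds share one factor, and they add up to the
  -- moment constant.
  have e1 : C / α = C / (α * (1 - α)) * (1 - α) := by field_simp
  have e2 : C / (1 - α) = C / (α * (1 - α)) * α := by field_simp
  rw [e1, Real.mul_rpow hs h1α.le] at hJl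
  rw [e2, Real.mul_rpow hs hα0.le] at hJr
  linarith

variable {Ω : Type*} [MeasurableSpace Ω] {P : Measure Ω} {Y : Ω → ℝ}

lemma ES_eq_add (hY : P.map Y ∈ momentSet p m v) (hα0 : 0 < α) (hα1 : α < 1) :
    ES P α Y = m + (∫ t in α..1, (leftQuantile (P.map Y) t - m)) / (1 - α) := by
  have h1α : 1 - α ≠ 0 := (sub_pos.2 hα1).ne'
  have hαm : α ∈ uIcc (0 : ℝ) 1 := by rw [uIcc_of_le zero_le_one]; exact ⟨hα0.le, hα1.le⟩
  have hI := (intervalIntegrable_leftQuantile hY).mono_set (uIcc_subset_uIcc hαm right_mem_uIcc)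
  rw [intervalIntegral.integral_sub hI intervalIntegrable_const,
    intervalIntegral.integral_const, smul_eq_mul]
  simp only [ES, VaR]
  field_simp
  ring

lemma leftES_eq_sub (hY : P.map Y ∈ momentSet p m v) (hα0 : 0 < α) (hα1 : α < 1) :
    leftES P α Y = m - (∫ t in α..1, (leftQuantile (P.map Y) t - m)) / α := by
  have hαm : α ∈ uIcc (0 : ℝ) 1 := by rw [uIcc_of_le zero_le_one]; exact ⟨hα0.le, hα1.le⟩
  have hI := (intervalIntegrable_leftQuantile hY).mono_set (uIcc_subset_uIcc left_mem_uIcc hαm)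
  rw [← neg_eq_of_add_eq_zero_right (integral_leftQuantile_add_adjacent hY hα0 hα1),
    intervalIntegral.integral_sub hI intervalIntegrable_const,
    intervalIntegral.integral_const, smul_eq_mul]
  simp only [leftES, VaR]
  field_simp
  ring

lemma ES_le (hY : P.map Y ∈ momentSet p m v) (hα0 : 0 < α) (hα1 : α < 1) (hp : 1 < p)
    (hv : 0 < v) :
    ES P α Y ≤ m + v * α * (α ^ p * (1 - α) + (1 - α) ^ p * α) ^ (-(1 / p)) := by
  have h := (le_abs_self _).trans (abs_integral_leftQuantile_le hY hα0 hα1 hp hv)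
  rw [ES_eq_add hY hα0 hα1, add_le_add_iff_left, div_le_iff₀ (sub_pos.2 hα1)]
  linarith

lemma le_leftES (hY : P.map Y ∈ momentSet p m v) (hα0 : 0 < α) (hα1 : α < 1) (hp : 1 < p)
    (hv : 0 < v) :
    m - v * (1 - α) * (α ^ p * (1 - α) + (1 - α) ^ p * α) ^ (-(1 / p)) ≤ leftES P α Y := by
  have h := (le_abs_self _).trans (abs_integral_leftQuantile_le hY hα0 hα1 hp hv)
  rw [leftES_eq_sub hY hα0 hα1, sub_le_sub_iff_left, div_le_iff₀ hα0]
  linarith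

lemma VaR_le_ES (hY : P.map Y ∈ momentSet p m v) (hα0 : 0 < α) (hα1 : α < 1) :
    VaR P α Y ≤ ES P α Y := by
  have h1α : 0 < 1 - α := sub_pos.2 hα1
  have hαm : α ∈ uIcc (0 : ℝ) 1 := by rw [uIcc_of_le zero_le_one]; exact ⟨hα0.le, hα1.le⟩
  have hI := (intervalIntegrable_leftQuantile hY).mono_set (uIcc_subset_uIcc hαm right_mem_uIcc)
  have h := intervalIntegral.integral_mono_on_of_le_Ioo hα1.le
    (intervalIntegrable_const (c := leftQuantile (P.map Y) α)) hI fun t ht ↦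
      monotoneOn_leftQuantile (P.map Y) ⟨hα0, hα1⟩ ⟨hα0.trans ht.1, ht.2⟩ ht.1.le
  rw [intervalIntegral.integral_const, smul_eq_mul] at h
  rw [ES, one_div, ← div_eq_inv_mul, le_div_iff₀' h1α]
  exact h

lemma leftES_le_VaR (hY : P.map Y ∈ momentSet p m v) (hα0 : 0 < α) (hα1 : α < 1) :
    leftES P α Y ≤ VaR P α Y := by
  have hαm : α ∈ uIcc (0 : ℝ) 1 := by rw [uIcc_of_le zero_le_one]; exact ⟨hα0.le, hα1.le⟩
  have hI := (intervalIntegrable_leftQuantile hY).mono_set (uIcc_subset_uIcc left_mem_uIcc hαm)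
  have h := intervalIntegral.integral_mono_on_of_le_Ioo hα0.le hI
    (intervalIntegrable_const (c := leftQuantile (P.map Y) α)) fun t ht ↦
      monotoneOn_leftQuantile (P.map Y) ⟨ht.1, ht.2.trans hα1⟩ ⟨hα0, hα1⟩ ht.2.le
  rw [intervalIntegral.integral_const, smul_eq_mul, sub_zero] at h
  rw [leftES, one_div, ← div_eq_inv_mul, div_le_iff₀' hα0]
  exact h

end Bounds

/-! ### Extremal two-point laws -/

section TwoPoint

/-- The law giving mass `β` to `a` and mass `1 - β` to `b`. -/
noncomputable def twoPointLaw (β a b : ℝ) : Measure ℝ :=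
  ENNReal.ofReal β • Measure.dirac a + ENNReal.ofReal (1 - β) • Measure.dirac b

variable {β a b : ℝ}

lemma isProbabilityMeasure_twoPointLaw (hβ0 : 0 ≤ β) (hβ1 : β ≤ 1) :
    IsProbabilityMeasure (twoPointLaw β a b) := by
  constructor
  simp [twoPointLaw, ← ENNReal.ofReal_add hβ0 (sub_nonneg.2 hβ1)]

lemma integrable_twoPointLaw (g : ℝ → ℝ) : Integrable g (twoPointLaw β a b) :=
  ((integrable_dirac (by simp)).smul_measure ENNReal.ofReal_ne_top).add_measure
    ((integrable_dirac (by simp)).smul_measure ENNReal.ofReal_ne_top)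

lemma integral_twoPointLaw (hβ0 : 0 ≤ β) (hβ1 : β ≤ 1) (g : ℝ → ℝ) :
    ∫ y, g y ∂(twoPointLaw β a b) = β * g a + (1 - β) * g b := by
  rw [twoPointLaw, integral_add_measure
    ((integrable_dirac (by simp)).smul_measure ENNReal.ofReal_ne_top)
    ((integrable_dirac (by simp)).smul_measure ENNReal.ofReal_ne_top),
    integral_smul_measure, integral_smul_measure, integral_dirac, integral_dirac,
    ENNReal.toReal_ofReal hβ0, ENNReal.toReal_ofReal (sub_nonneg.2 hβ1), smul_eq_mul, smul_eq_mul]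

lemma Atomless.exists_map_eq_twoPointLaw {Ω : Type*} [MeasurableSpace Ω] {P : Measure Ω}
    [IsProbabilityMeasure P] (hP : Atomless P) (hβ0 : 0 ≤ β) (hβ1 : β ≤ 1) (a b : ℝ) :
    ∃ Y : Ω → ℝ, Measurable Y ∧ P.map Y = twoPointLaw β a b := by
  classical
  obtain ⟨A, hA, hAβ⟩ := hP.exists_real_eq hβ0 hβ1
  have hY : Measurable (A.piecewise (fun _ ↦ a) fun _ ↦ b) :=
    measurable_const.piecewise hA measurable_const
  refine ⟨_, hY, ?_⟩
  have h1 : (P.restrict A).map (A.piecewise (fun _ ↦ a) fun _ ↦ b) =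
      ENNReal.ofReal β • Measure.dirac a := by
    rw [Measure.map_congr (piecewise_ae_eq_restrict hA), Measure.map_const,
      Measure.restrict_apply_univ, ← hAβ, ofReal_measureReal]
  have h2 : (P.restrict Aᶜ).map (A.piecewise (fun _ ↦ a) fun _ ↦ b) =
      ENNReal.ofReal (1 - β) • Measure.dirac b := by
    rw [Measure.map_congr (piecewise_ae_eq_restrict_compl hA), Measure.map_const,
      Measure.restrict_apply_univ, ← hAβ, ← probReal_compl_eq_one_sub hA, ofReal_measureReal]
  rw [← Measure.restrict_add_restrict_compl (μ := P) hA, Measure.map_add _ _ hY, h1, h2, twoPointLaw]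

lemma cdf_twoPointLaw (hβ0 : 0 ≤ β) (hβ1 : β ≤ 1) (x : ℝ) :
    cdf (twoPointLaw β a b) x = (if a ≤ x then β else 0) + if b ≤ x then 1 - β else 0 := by
  have := isProbabilityMeasure_twoPointLaw (a := a) (b := b) hβ0 hβ1
  rw [cdf_eq_real, ← integral_indicator_one measurableSet_Iic, integral_twoPointLaw hβ0 hβ1]
  simp [indicator_apply]

lemma leftQuantile_twoPointLaw_of_le {t : ℝ} (hβ1 : β ≤ 1) (hab : a < b) (ht0 : 0 < t)
    (ht : t ≤ β) : leftQuantile (twoPointLaw β a b) t = a := by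
  have h : {x : ℝ | t ≤ cdf (twoPointLaw β a b) x} = Ici a := by
    ext x
    rw [mem_ofPred_eq, cdf_twoPointLaw (ht0.le.trans ht) hβ1, mem_Ici]
    constructor
    · intro hx
      by_contra hax
      rw [if_neg hax, if_neg fun h ↦ hax (hab.le.trans h)] at hx
      linarith
    · intro hax
      rw [if_pos hax]
      split_ifs <;> linarith
  rw [leftQuantile, h, csInf_Ici]

lemma leftQuantile_twoPointLaw_of_lt {t : ℝ} (hβ0 : 0 ≤ β) (hab : a < b) (ht : β < t)
    (ht1 : t ≤ 1) : leftQuantile (twoPointLaw β a b) t = b := by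
  have h : {x : ℝ | t ≤ cdf (twoPointLaw β a b) x} = Ici b := by
    ext x
    rw [mem_ofPred_eq, cdf_twoPointLaw hβ0 (ht.le.trans ht1), mem_Ici]
    constructor
    · intro hx
      by_contra hbx
      rw [if_neg hbx] at hx
      split_ifs at hx <;> linarith
    · intro hbx
      rw [if_pos hbx, if_pos (hab.le.trans hbx)]
      linarith
  rw [leftQuantile, h, csInf_Ici]

/-- The two-point laws that extremise the tail functionals lie in the moment set. -/
lemma twoPointLaw_mem_momentSet {p v s : ℝ} (m : ℝ) (hβ0 : 0 ≤ β) (hβ1 : β ≤ 1)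
    (hs : 0 ≤ s) (h : s ^ p * (β ^ p * (1 - β) + (1 - β) ^ p * β) ≤ v ^ p) :
    twoPointLaw β (m - s * (1 - β)) (m + s * β) ∈ momentSet p m v := by
  refine ⟨isProbabilityMeasure_twoPointLaw hβ0 hβ1, integrable_twoPointLaw _, ?_,
    integrable_twoPointLaw _, ?_⟩
  · rw [integral_twoPointLaw hβ0 hβ1]
    ring
  · have h1β : 0 ≤ 1 - β := sub_nonneg.2 hβ1
    rw [integral_twoPointLaw hβ0 hβ1, sub_sub_cancel_left, add_sub_cancel_left, abs_neg,
      abs_of_nonneg (by positivity), abs_of_nonneg (by positivity), Real.mul_rpow hs h1β,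
      Real.mul_rpow hs hβ0]
    linarith

/-- The distance between the atoms is chosen to exhaust the moment bound. The mass `β` stays free,
since the supremum of `VaR` needs masses other than `α`. -/
lemma Atomless.exists_extremal {Ω : Type*} [MeasurableSpace Ω] {P : Measure Ω}
    [IsProbabilityMeasure P] (hP : Atomless P) {p v : ℝ} (m : ℝ) (hβ0 : 0 < β) (hβ1 : β < 1)
    (hp : 1 < p) (hv : 0 < v) :
    ∃ Y ∈ withLawIn P (momentSet p m v),
      (∀ t, 0 < t → t ≤ β → VaR P t Y =
        m - v * (1 - β) * (β ^ p * (1 - β) + (1 - β) ^ p * β) ^ (-(1 / p))) ∧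
      ∀ t, β < t → t ≤ 1 → VaR P t Y =
        m + v * β * (β ^ p * (1 - β) + (1 - β) ^ p * β) ^ (-(1 / p)) := by
  have hK := momentConstant_pos p hβ0 hβ1
  set K := β ^ p * (1 - β) + (1 - β) ^ p * β
  have hs : 0 < v * K ^ (-(1 / p)) := by positivity
  obtain ⟨Y, hY, hlaw⟩ := hP.exists_map_eq_twoPointLaw hβ0.le hβ1.le
    (m - v * K ^ (-(1 / p)) * (1 - β)) (m + v * K ^ (-(1 / p)) * β)
  have hab : m - v * K ^ (-(1 / p)) * (1 - β) < m + v * K ^ (-(1 / p)) * β := by linarith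
  refine ⟨Y, ⟨hY, ?_⟩, fun t ht0 ht ↦ ?_, fun t ht ht1 ↦ ?_⟩
  · rw [hlaw]
    exact twoPointLaw_mem_momentSet m hβ0.le hβ1.le hs.le
      (mul_rpow_neg_inv_rpow (by linarith) hv.le hK).le
  · rw [VaR, hlaw, leftQuantile_twoPointLaw_of_le hβ1.le hab ht0 ht, mul_right_comm]
  · rw [VaR, hlaw, leftQuantile_twoPointLaw_of_lt hβ0.le hab ht ht1, mul_right_comm]

end TwoPoint

/-! ### Attainment and the limit `β ↑ α` -/

lemma ES_eq_of_VaR_eq {Ω : Type*} [MeasurableSpace Ω] {P : Measure Ω} {Y : Ω → ℝ} {α c : ℝ}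
    (hα1 : α < 1) (h : ∀ t, α < t → t ≤ 1 → VaR P t Y = c) : ES P α Y = c := by
  have hI : ∫ t in α..1, VaR P t Y = ∫ _ in α..1, c := by
    rw [intervalIntegral.integral_of_le hα1.le, intervalIntegral.integral_of_le hα1.le]
    exact setIntegral_congr_fun measurableSet_Ioc fun t ht ↦ h t ht.1 ht.2
  rw [ES, hI, intervalIntegral.integral_const, smul_eq_mul, ← mul_assoc,
    one_div_mul_cancel (sub_pos.2 hα1).ne', one_mul]

lemma leftES_eq_of_VaR_eq {Ω : Type*} [MeasurableSpace Ω] {P : Measure Ω} {Y : Ω → ℝ} {α c : ℝ}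
    (hα0 : 0 < α) (h : ∀ t, 0 < t → t ≤ α → VaR P t Y = c) : leftES P α Y = c := by
  have hI : ∫ t in (0 : ℝ)..α, VaR P t Y = ∫ _ in (0 : ℝ)..α, c := by
    rw [intervalIntegral.integral_of_le hα0.le, intervalIntegral.integral_of_le hα0.le]
    exact setIntegral_congr_fun measurableSet_Ioc fun t ht ↦ h t ht.1 ht.2
  rw [leftES, hI, intervalIntegral.integral_const, smul_eq_mul, sub_zero, ← mul_assoc,
    one_div_mul_cancel hα0.ne', one_mul]

lemma continuousAt_upperBound {α p : ℝ} (m v : ℝ) (hα0 : 0 < α) (hα1 : α < 1) :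
    ContinuousAt (fun β : ℝ ↦
      m + v * β * (β ^ p * (1 - β) + (1 - β) ^ p * β) ^ (-(1 / p))) α := by
  have h1α : 1 - α ≠ 0 := (sub_pos.2 hα1).ne'
  have hK : α ^ p * (1 - α) + (1 - α) ^ p * α ≠ 0 := (momentConstant_pos p hα0 hα1).ne'
  have h1 : ContinuousAt (fun β : ℝ ↦ β ^ p) α := continuousAt_id.rpow_const (Or.inl hα0.ne')
  have h2 : ContinuousAt (fun β : ℝ ↦ (1 - β) ^ p) α :=
    (continuousAt_const.sub continuousAt_id).rpow_const (Or.inl h1α)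
  have h3 : ContinuousAt (fun β : ℝ ↦ β ^ p * (1 - β) + (1 - β) ^ p * β) α :=
    (h1.mul (continuousAt_const.sub continuousAt_id)).add (h2.mul continuousAt_id)
  have h4 : ContinuousAt (fun β : ℝ ↦
      (β ^ p * (1 - β) + (1 - β) ^ p * β) ^ (-(1 / p))) α := h3.rpow_const (Or.inl hK)
  exact continuousAt_const.add ((continuousAt_const.mul continuousAt_id).mul h4)

end RiskMeasure

theorem corollary1 {Ω : Type*} [MeasurableSpace Ω] (P : MeasureTheory.Measure Ω)
    [MeasureTheory.IsProbabilityMeasure P] (hP : RiskMeasure.Atomless P)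
    (α p m v : ℝ) (hα0 : 0 < α) (hα1 : α < 1) (hp : 1 < p) (hv : 0 < v) :
    -- the integrals that define `ES` and `leftES` exist
    (∀ Y ∈ RiskMeasure.withLawIn P (RiskMeasure.momentSet p m v),
      IntervalIntegrable (fun t : ℝ => RiskMeasure.VaR P t Y) MeasureTheory.volume 0 1) ∧
    -- supremum of `VaR` and maximum of `ES`
    (IsLUB (RiskMeasure.VaR P α '' RiskMeasure.withLawIn P (RiskMeasure.momentSet p m v))
        (m + v * α * (α ^ p * (1 - α) + (1 - α) ^ p * α) ^ (-(1 / p))) ∧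
      IsGreatest (RiskMeasure.ES P α '' RiskMeasure.withLawIn P (RiskMeasure.momentSet p m v))
        (m + v * α * (α ^ p * (1 - α) + (1 - α) ^ p * α) ^ (-(1 / p)))) ∧
    -- infimum of `VaR` and minimum of the left `ES`
    (IsGLB (RiskMeasure.VaR P α '' RiskMeasure.withLawIn P (RiskMeasure.momentSet p m v))
        (m - v * (1 - α) * (α ^ p * (1 - α) + (1 - α) ^ p * α) ^ (-(1 / p))) ∧
      IsLeast (RiskMeasure.leftES P α '' RiskMeasure.withLawIn P (RiskMeasure.momentSet p m v))
        (m - v * (1 - α) * (α ^ p * (1 - α) + (1 - α) ^ p * α) ^ (-(1 / p)))) := by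
  obtain ⟨Y, hY, hlow, hhigh⟩ := hP.exists_extremal m hα0 hα1 hp hv
  refine ⟨fun Z hZ ↦ RiskMeasure.intervalIntegrable_leftQuantile hZ.2, ⟨⟨?_, ?_⟩, ⟨?_, ?_⟩⟩,
    ⟨⟨?_, ?_⟩, ⟨?_, ?_⟩⟩⟩
  · rintro _ ⟨Z, hZ, rfl⟩
    exact (RiskMeasure.VaR_le_ES hZ.2 hα0 hα1).trans (RiskMeasure.ES_le hZ.2 hα0 hα1 hp hv)
  · intro w hw
    -- For `β < α` the level `α` falls on the upper atom; continuity of the bound in `β` passes to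
    -- the limit.
    refine le_of_tendsto ((RiskMeasure.continuousAt_upperBound m v hα0 hα1).mono_left
      (nhdsWithin_le_nhds (s := Set.Iio α))) ?_
    filter_upwards [Ioo_mem_nhdsLT hα0] with β hβ
    obtain ⟨Z, hZ, -, hZhigh⟩ := hP.exists_extremal m hβ.1 (hβ.2.trans hα1) hp hv
    exact hw ⟨Z, hZ, hZhigh α hβ.2 hα1.le⟩
  · exact ⟨Y, hY, RiskMeasure.ES_eq_of_VaR_eq hα1 hhigh⟩
  · rintro _ ⟨Z, hZ, rfl⟩
    exact RiskMeasure.ES_le hZ.2 hα0 hα1 hp hv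
  · rintro _ ⟨Z, hZ, rfl⟩
    exact (RiskMeasure.le_leftES hZ.2 hα0 hα1 hp hv).trans (RiskMeasure.leftES_le_VaR hZ.2 hα0 hα1)
  · exact fun w hw ↦ hw ⟨Y, hY, hlow α hα0 le_rfl⟩
  · exact ⟨Y, hY, RiskMeasure.leftES_eq_of_VaR_eq hα0 hlow⟩
  · rintro _ ⟨Z, hZ, rfl⟩
    exact RiskMeasure.le_leftES hZ.2 hα0 hα1 hp hv
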